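/- **Theorem.** Let $\varphi:(0,\infty)\to(0,\infty)$ be *admissible*, i.e. $\varphi$ is increasing (in the weak sense), $\varphi(x)/x$ is bounded on $(0,1]$, $\varphi(x)/x^2$ is decreasing (in the weak sense) on $(0,\infty)$, and $\varphi(x+h(x))\asymp\varphi(x)$ as $x\downarrow 0$ whenever $h(x)=o(x)$. Let $I=\gamma B S_\mu$ be an inner function on the unit disk $\mathbb D$, where $|\gamma|=1$, $B$ is the Blaschke product with the (finite or infinite, possibly empty) family of zeros $\{\lambda_n\}\subset\mathbb D$, repeated according to multiplicity, $\sum_n(1-|\lambda_n|)<\infty$, and $$S_\mu(z)=\exp\Big(-\int_{\mathbb T}\frac{\xi+z}{\xi-z}\,d\mu(\xi)\Big)$$ with $\mu$ a finite positive Borel measure on the unit circle $\mathbb T$ that is singular with respect to arc length. Suppose that $$\sum_n\frac{1-|\lambda_n|}{\varphi(|1-\lambda_n|)}+\int_{\mathbb T}\frac{1}{\varphi(|1-\xi|)}\,d\mu(\xi)<\infty ,$$ where $1/\varphi(0)=\infty$ (consistently with $\varphi(0+)=0$), so that $\mu(\{1\})=0$. Let $k^I_\lambda$ be the reproducing kernel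 at $\lambda\in\mathbb D$ of the model space $(IH^2)^\perp$, the orthogonal complement of $IH^2$ in the Hardy space $H^2$ of $\mathbb D$, and let $\|\cdot\|$ be the norm of $H^2$. Then for every $r\in(0,1)$ $$k^I_r(z)=\frac{1-\overline{I(r)}\,I(z)}{1-rz}\quad(z\in\mathbb D),\qquad \|k^I_r\|^2=\frac{1-|I(r)|^2}{1-r^2},$$ and there is a constant $C>0$, independent of $r$, such that $$\|k^I_r\|^2\le C\,\frac{\varphi(1-r)}{(1-r)^2}\qquad\text{for all } r\in(0,1).$$ -/

import Mathlib

open Set Filter Topology MeasureTheory Asymptotics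
open scoped ENNReal ComplexConjugate Complex.UnitDisc

noncomputable section

/-! ### The Hardy space of the disk as a reproducing kernel Hilbert space -/

/-- The Hardy space `H²`: an element is given by its square-summable sequence of Taylor coefficients
at `0`, with the norm `‖f‖² = ∑ |aₙ|²`. Its elements are seen as functions on the open unit disk
through the instance of `RKHS` below. -/
def HardySpace : Type := lp (fun _ : ℕ => ℂ) 2

namespace HardySpace

instance : NormedAddCommGroup HardySpace :=
  inferInstanceAs (NormedAddCommGroup (lp (fun _ : ℕ => ℂ) 2))

instance : InnerProductSpace ℂ HardySpace :=
  inferInstanceAs (InnerProductSpace ℂ (lp (fun _ : ℕ => ℂ) 2))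

instance : CompleteSpace HardySpace :=
  inferInstanceAs (CompleteSpace (lp (fun _ : ℕ => ℂ) 2))

/-- The `n`-th Taylor coefficient of `f` at `0`. -/
def coeff (f : HardySpace) (n : ℕ) : ℂ := (show lp (fun _ : ℕ => ℂ) 2 from f) n

/-- The sequence `(conj z ^ n)` is square-summable. -/
theorem memℓp_conj_pow (z : 𝔻) :
    Memℓp (fun n : ℕ => (conj (z : ℂ)) ^ n) (2 : ℝ≥0∞) := by
  rw [memℓp_gen_iff (by norm_num)]
  have h : Summable fun n : ℕ => (‖(z : ℂ)‖ ^ 2) ^ n :=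
    summable_geometric_of_lt_one (by positivity) z.sq_norm_lt_one
  refine h.congr fun n => ?_
  simp [← pow_mul, mul_comm]

/-- The function `w ↦ 1 / (1 - conj z * w)`, given by its Taylor coefficients. -/
def szego (z : 𝔻) : HardySpace :=
  (⟨fun n : ℕ => (conj (z : ℂ)) ^ n, memℓp_conj_pow z⟩ : lp (fun _ : ℕ => ℂ) 2)

theorem hasSum_inner_szego (z : 𝔻) (f : HardySpace) :
    HasSum (fun n => f.coeff n * (z : ℂ) ^ n) (inner ℂ (szego z) f) := by
  have h := lp.hasSum_inner (𝕜 := ℂ) (show lp (fun _ : ℕ => ℂ) 2 from szego z)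
    (show lp (fun _ : ℕ => ℂ) 2 from f)
  refine h.congr_fun fun n => ?_
  simp [szego, coeff]

/-- Evaluation at a point `z` of the disk, `f(z) = ∑ aₙ zⁿ`. -/
def evalCLM (z : 𝔻) : HardySpace →L[ℂ] ℂ :=
  ((innerSL ℂ (szego z)).copy (fun f => ∑' n, f.coeff n * (z : ℂ) ^ n)
    (funext fun f => (hasSum_inner_szego z f).tsum_eq))

theorem evalCLM_injective {f g : HardySpace} (h : ∀ z : 𝔻, evalCLM z f = evalCLM z g) :
    f = g := by
  have key : ∀ f : HardySpace, HasFPowerSeriesAt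
      (fun w : ℂ => ∑' n, f.coeff n * w ^ n) (FormalMultilinearSeries.ofScalars ℂ f.coeff) 0 := by
    intro f
    rw [hasFPowerSeriesAt_iff]
    filter_upwards [Metric.ball_mem_nhds (0 : ℂ) one_pos] with w hw
    have hs := (hasSum_inner_szego (Complex.UnitDisc.mk w (mem_ball_zero_iff.1 hw)) f).summable
    simp only [Complex.UnitDisc.coe_mk] at hs
    simpa [FormalMultilinearSeries.coeff_ofScalars, mul_comm] using hs.hasSum
  have heq : (fun w : ℂ => ∑' n, f.coeff n * w ^ n) =ᶠ[𝓝 0]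
      fun w : ℂ => ∑' n, g.coeff n * w ^ n := by
    filter_upwards [Metric.ball_mem_nhds (0 : ℂ) one_pos] with w hw
    exact h (Complex.UnitDisc.mk w (mem_ball_zero_iff.1 hw))
  have hp := ((key f).congr heq).eq_formalMultilinearSeries (key g)
  refine lp.ext (funext fun n => ?_)
  have hc := congrArg (fun p => FormalMultilinearSeries.coeff p n) hp
  have hn : f.coeff n = g.coeff n := by
    simpa [FormalMultilinearSeries.coeff_ofScalars] using hc
  exact hn

/-- `H²` as a reproducing kernel Hilbert space on the disk: for `f : HardySpace` and `z : 𝔻`,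
`f z = ∑ aₙ zⁿ`. -/
instance : RKHS ℂ HardySpace 𝔻 ℂ where
  coeCLM := ContinuousLinearMap.pi evalCLM
  coeCLM_injective := fun _ _ h => evalCLM_injective fun z => congrFun h z

theorem apply_eq_tsum (f : HardySpace) (z : 𝔻) : f z = ∑' n, f.coeff n * (z : ℂ) ^ n := rfl

end HardySpace

/-- The subspace `I H² = {I g : g ∈ H²}` of `H²` (all those products that lie in `H²`,
which is every product when `I` is bounded and analytic). -/
def multipleSubspace (I : ℂ → ℂ) : Submodule ℂ HardySpace where
  carrier := {f | ∃ g : HardySpace, ∀ z : 𝔻, f z = I z * g z}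
  zero_mem' := ⟨0, fun z => by simp⟩
  add_mem' := by
    rintro f₁ f₂ ⟨g₁, h₁⟩ ⟨g₂, h₂⟩
    exact ⟨g₁ + g₂, fun z => by simp [h₁, h₂, mul_add]⟩
  smul_mem' := by
    rintro c f ⟨g, h⟩
    exact ⟨c • g, fun z => by simp [h]; ring⟩

/-- The model space `(I H²)ᗮ`. -/
abbrev modelSpace (I : ℂ → ℂ) : Submodule ℂ HardySpace := (multipleSubspace I)ᗮ

/-- The model space as a Hilbert space of functions on the disk, with the norm of `H²`. -/
instance modelSpace.instRKHS (I : ℂ → ℂ) : RKHS ℂ (modelSpace I) 𝔻 ℂ where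
  coeCLM := (RKHS.coeCLM ℂ (H := HardySpace)).comp (modelSpace I).subtypeL
  coeCLM_injective := RKHS.coeCLM_injective.comp Subtype.coe_injective

/-- The reproducing kernel of `(I H²)ᗮ` at the point `w`: the element `k` of `(I H²)ᗮ` with
`⟪f, k⟫ = f(w)` for all `f` in `(I H²)ᗮ`. -/
def modelKernel (I : ℂ → ℂ) (w : 𝔻) : modelSpace I := RKHS.kerFun (modelSpace I) w 1

/-! ### Inner functions and their factorization -/

/-- The unit circle, with its Borel `σ`-algebra. -/
abbrev UnitCircle : Type := Metric.sphere (0 : ℂ) 1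

/-- The point `exp (i t)` of the unit circle. -/
def circlePoint (t : ℝ) : UnitCircle :=
  ⟨Complex.exp (t * Complex.I), by simp [Complex.norm_exp_ofReal_mul_I]⟩

/-- Arc length on the unit circle. -/
def arcLength : Measure UnitCircle :=
  (volume.restrict (Ioc (-Real.pi) Real.pi)).map circlePoint

/-- `I` (a function of which only the values on the open unit disk matter) is inner: bounded by `1`
and analytic on the disk, with radial limits of modulus one almost everywhere. -/
structure IsInner (I : ℂ → ℂ) : Prop where
  differentiableOn : DifferentiableOn ℂ I (Metric.ball 0 1)
  norm_le_one : ∀ z ∈ Metric.ball (0 : ℂ) 1, ‖I z‖ ≤ 1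
  radial_limit : ∀ᵐ t : ℝ, ∃ w : ℂ, ‖w‖ = 1 ∧
    Tendsto (fun ρ : ℝ => I (ρ * circlePoint t)) (𝓝[<] 1) (𝓝 w)

/-- The Blaschke factor with zero `a`. -/
def blaschkeFactor (a z : ℂ) : ℂ :=
  if a = 0 then z else (‖a‖ : ℂ) / a * ((a - z) / (1 - conj a * z))

/-- The Blaschke product with zeros `lam n`, repeated according to multiplicity. -/
def blaschkeProduct {ι : Type*} (lam : ι → ℂ) (z : ℂ) : ℂ := ∏' n, blaschkeFactor (lam n) z

/-- The singular inner function `S_μ`. -/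
def singularInner (μ : Measure UnitCircle) (z : ℂ) : ℂ :=
  Complex.exp (-∫ ζ : UnitCircle, ((ζ : ℂ) + z) / ((ζ : ℂ) - z) ∂μ)

/-- `I = γ B S_μ` on the disk for a constant `γ` of modulus one, where `B` is the Blaschke product
with the zeros `lam n` (finitely or infinitely many, or none) and `μ` is a finite positive Borel
measure on the circle that is singular with respect to arc length. -/
structure IsFactorization {ι : Type*} (I : ℂ → ℂ) (lam : ι → ℂ) (μ : Measure UnitCircle) :
    Prop where
  norm_lt_one : ∀ n, ‖lam n‖ < 1
  blaschke_condition : Summable fun n => 1 - ‖lam n‖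
  isFiniteMeasure : IsFiniteMeasure μ
  mutuallySingular : μ ⟂ₘ arcLength
  eq_mul : ∃ γ : ℂ, ‖γ‖ = 1 ∧
    ∀ z ∈ Metric.ball (0 : ℂ) 1, I z = γ * blaschkeProduct lam z * singularInner μ z

/-! ### Admissible functions -/

/-- Admissibility of a function on `(0, ∞)` (other values of `φ` are irrelevant). -/
structure IsAdmissible (φ : ℝ → ℝ) : Prop where
  pos : ∀ x, 0 < x → 0 < φ x
  monotoneOn : MonotoneOn φ (Ioi 0)
  bounded_div : ∃ M : ℝ, ∀ x ∈ Ioc (0 : ℝ) 1, φ x / x ≤ M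
  antitoneOn_div_sq : AntitoneOn (fun x => φ x / x ^ 2) (Ioi 0)
  isTheta : ∀ h : ℝ → ℝ, h =o[𝓝[>] 0] (fun x => x) →
    (fun x => φ (x + h x)) =Θ[𝓝[>] 0] φ

/-- `φ` on `[0, ∞)` with its limit `φ(0+) = 0` as the value at `0`, so that `1 / φ` is `∞` there. -/
def extendZero (φ : ℝ → ℝ) (x : ℝ) : ℝ≥0∞ := if x = 0 then 0 else ENNReal.ofReal (φ x)

/-- The quantity `∑ (1 - |lam n|) / φ(|1 - lam n|) + ∫ 1 / φ(|1 - ζ|) dμ(ζ)`, in `[0, ∞]`. -/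
def growthSum {ι : Type*} (φ : ℝ → ℝ) (lam : ι → ℂ) (μ : Measure UnitCircle) : ℝ≥0∞ :=
  ∑' n, ENNReal.ofReal (1 - ‖lam n‖) / extendZero φ ‖1 - lam n‖ +
    ∫⁻ ζ : UnitCircle, 1 / extendZero φ ‖1 - (ζ : ℂ)‖ ∂μ

/-- The point `r ∈ (0, 1)` as a point of the disk. -/
def radialPoint (r : ℝ) (hr : r ∈ Ioo (0 : ℝ) 1) : 𝔻 :=
  Complex.UnitDisc.mk (r : ℂ) (by
    rw [Complex.norm_real, Real.norm_eq_abs, abs_lt]; exact ⟨by linarith [hr.1], hr.2⟩)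

end

/-! Since `|I| = 1` a.e. on the circle, Parseval on circles `|z| = ρ → 1` shows that the functions
`I zⁿ` are orthonormal, so multiplication by `I` is an isometry `T` of `H²`
(`IsInner.exists_isometry`). Subtracting `conj (I w) • T (szego w)` from `szego w` gives an element
orthogonal to `I H²` that still evaluates at `w` on the model space; this is the kernel, and its
value at `w` is its squared norm.

It remains to bound `1 - |I(r)|²`. It is at most the sum of the same defects of `B` and `S_μ`, which
are controlled by `∑ (1 - |λₙ|²)(1 - r²) / |1 - conj λₙ r|²` and by twice the Poisson integral of
`μ`. In both, `IsAdmissible.mul_sq_le` yields `1 / |1 - conj a r|² ≤ 4 (φ(1-r) / (1-r)²) / φ(|1-a|)`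
for `|a| ≤ 1`, which turns the bound into a multiple of `growthSum`; the factor `1 - r²` cancels
against the denominator of the norm. -/

/-! ### Fourier series and Parseval's formula on circles -/

theorem norm_circlePoint (t : ℝ) : ‖(circlePoint t : ℂ)‖ = 1 := by
  simp [circlePoint, Complex.norm_exp_ofReal_mul_I]

theorem continuous_circlePoint : Continuous fun t : ℝ => (circlePoint t : ℂ) := by
  simp only [circlePoint]
  fun_prop

theorem norm_mul_circlePoint_lt_one {ρ : ℝ} (hρ : ρ ∈ Ioo (0 : ℝ) 1) (t : ℝ) :
    ‖(ρ : ℂ) * circlePoint t‖ < 1 := by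
  rw [norm_mul, norm_circlePoint, mul_one, Complex.norm_real, Real.norm_of_nonneg hρ.1.le]
  exact hρ.2

theorem integral_conj_circlePoint_pow_mul_pow (m n : ℕ) :
    ∫ t in -Real.pi..Real.pi, conj ((circlePoint t : ℂ) ^ m) * (circlePoint t : ℂ) ^ n
      = if m = n then 2 * (Real.pi : ℂ) else 0 := by
  have h : ∀ t : ℝ, conj ((circlePoint t : ℂ) ^ m) * (circlePoint t : ℂ) ^ n
      = Complex.exp ((((n : ℂ) - m) * Complex.I) * t) := by
    intro t
    simp only [circlePoint]
    rw [← Complex.exp_nat_mul, ← Complex.exp_nat_mul, ← Complex.exp_conj, ← Complex.exp_add]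
    congr 1
    simp only [map_mul, Complex.conj_natCast, Complex.conj_ofReal, Complex.conj_I]
    ring
  simp_rw [h]
  split_ifs with hmn
  · subst hmn
    simp
    ring
  · have hc : ((n : ℂ) - m) * Complex.I ≠ 0 :=
      mul_ne_zero (sub_ne_zero.2 fun e => hmn (by exact_mod_cast e.symm)) Complex.I_ne_zero
    rw [integral_exp_mul_complex hc, div_eq_zero_iff]
    left
    rw [sub_eq_zero, Complex.exp_eq_exp_iff_exists_int]
    refine ⟨(n : ℤ) - m, ?_⟩
    push_cast
    ring

/-- Termwise integration of `f * ∑ bₙ e^{int}` for a bounded continuous function `f`. -/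
theorem hasSum_integral_mul_circlePoint_pow {f : ℝ → ℂ} (hf : Continuous f) {M : ℝ}
    (hM : ∀ t, ‖f t‖ ≤ M) {b : ℕ → ℂ} (hb : Summable fun n => ‖b n‖) :
    HasSum (fun n => b n * ∫ t in -Real.pi..Real.pi, f t * (circlePoint t : ℂ) ^ n)
      (∫ t in -Real.pi..Real.pi, f t * ∑' n, b n * (circlePoint t : ℂ) ^ n) := by
  have hc := continuous_circlePoint
  simp_rw [← intervalIntegral.integral_const_mul]
  refine intervalIntegral.hasSum_integral_of_dominated_convergence
    (fun n _ => ‖b n‖ * M) (fun n => ?_) (fun n => ?_) ?_ ?_ ?_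
  · exact (by fun_prop : Continuous _).aestronglyMeasurable
  · refine .of_forall fun t _ => ?_
    rw [norm_mul, norm_mul, norm_pow, norm_circlePoint, one_pow, mul_one]
    exact mul_le_mul_of_nonneg_left (hM t) (norm_nonneg _)
  · exact .of_forall fun t _ => hb.mul_right M
  · exact intervalIntegrable_const
  · refine .of_forall fun t _ => ?_
    have hs : Summable fun n => b n * (circlePoint t : ℂ) ^ n :=
      .of_norm (by simpa [norm_circlePoint] using hb)
    exact (hs.hasSum.mul_left (f t)).congr_fun fun n => by ring

theorem continuous_tsum_mul_circlePoint_pow {a : ℕ → ℂ} (ha : Summable fun n => ‖a n‖) :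
    Continuous fun t : ℝ => ∑' n, a n * (circlePoint t : ℂ) ^ n := by
  have hc := continuous_circlePoint
  exact continuous_tsum (fun n => by fun_prop) ha fun n t => by simp

theorem norm_tsum_mul_circlePoint_pow_le {a : ℕ → ℂ} (ha : Summable fun n => ‖a n‖) (t : ℝ) :
    ‖∑' n, a n * (circlePoint t : ℂ) ^ n‖ ≤ ∑' n, ‖a n‖ := by
  have h := norm_tsum_le_tsum_norm (f := fun n => a n * (circlePoint t : ℂ) ^ n)
    (by simpa [norm_circlePoint] using ha)
  simpa [norm_circlePoint] using h

/-- Parseval's formula for two absolutely convergent series `∑ aₙ e^{int}`, `∑ bₙ e^{int}`. -/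
theorem integral_conj_tsum_mul_tsum {a b : ℕ → ℂ} (ha : Summable fun n => ‖a n‖)
    (hb : Summable fun n => ‖b n‖) :
    ∫ t in -Real.pi..Real.pi, conj (∑' n, a n * (circlePoint t : ℂ) ^ n) *
        ∑' n, b n * (circlePoint t : ℂ) ^ n
      = 2 * Real.pi * ∑' n, conj (a n) * b n := by
  have hc := continuous_circlePoint
  have key : ∀ m : ℕ, ∫ t in -Real.pi..Real.pi,
      conj (∑' n, a n * (circlePoint t : ℂ) ^ n) * (circlePoint t : ℂ) ^ m
        = 2 * Real.pi * conj (a m) := by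
    intro m
    have h := hasSum_integral_mul_circlePoint_pow (f := fun t => conj ((circlePoint t : ℂ) ^ m))
      (by fun_prop) (M := 1) (fun t => by simp) ha
    simp_rw [integral_conj_circlePoint_pow_mul_pow] at h
    have h' := h.unique (hasSum_single m fun n hn => by simp [Ne.symm hn])
    rw [if_pos rfl] at h'
    -- The integral sought is the conjugate of the one just computed.
    have h2 := congrArg conj h'
    simp only [intervalIntegral, map_sub, ← integral_conj] at h2
    have h3 : ∀ t : ℝ, conj (∑' n, a n * (circlePoint t : ℂ) ^ n) * (circlePoint t : ℂ) ^ m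
        = conj (conj ((circlePoint t : ℂ) ^ m) * ∑' n, a n * (circlePoint t : ℂ) ^ n) := by
      intro t
      rw [map_mul, Complex.conj_conj, mul_comm]
    simp_rw [h3]
    simp only [intervalIntegral]
    rw [h2, map_mul, map_mul, Complex.conj_ofReal, Complex.conj_ofNat, mul_comm]
  have h := hasSum_integral_mul_circlePoint_pow
    (f := fun t => conj (∑' n, a n * (circlePoint t : ℂ) ^ n))
    (Complex.continuous_conj.comp (continuous_tsum_mul_circlePoint_pow ha))
    (fun t => by
      rw [RCLike.norm_conj]
      exact norm_tsum_mul_circlePoint_pow_le ha t) hb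
  simp_rw [key] at h
  rw [← h.tsum_eq, ← tsum_mul_left]
  exact tsum_congr fun n => by ring

theorem tsum_mul_ofReal_mul_pow (a : ℕ → ℂ) (ρ : ℝ) (u : ℂ) :
    ∑' n, a n * ((ρ : ℂ) * u) ^ n = ∑' n, a n * (ρ : ℂ) ^ n * u ^ n :=
  tsum_congr fun n => by rw [mul_pow]; ring

/-- Parseval's formula on the circle of radius `ρ`. -/
theorem integral_conj_mul_of_hasSum {a b : ℕ → ℂ} {F G : ℂ → ℂ}
    (hF : ∀ z, ‖z‖ < 1 → HasSum (fun n => a n * z ^ n) (F z))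
    (hG : ∀ z, ‖z‖ < 1 → HasSum (fun n => b n * z ^ n) (G z))
    {ρ : ℝ} (hρ : ρ ∈ Ioo (0 : ℝ) 1) :
    ∫ t in -Real.pi..Real.pi, conj (F (ρ * circlePoint t)) * G (ρ * circlePoint t)
      = 2 * Real.pi * ∑' n, conj (a n) * b n * (ρ ^ 2) ^ n := by
  have hρ1 : ‖(ρ : ℂ)‖ < 1 := by
    rw [Complex.norm_real, Real.norm_of_nonneg hρ.1.le]
    exact hρ.2
  -- Convergence at the single point `z = ρ` already gives absolute summability of `aₙ ρⁿ` and `bₙ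
  -- ρⁿ`.
  have h := integral_conj_tsum_mul_tsum (hF ρ hρ1).summable.norm (hG ρ hρ1).summable.norm
  simp_rw [← tsum_mul_ofReal_mul_pow] at h
  simp_rw [fun t => (hF _ (norm_mul_circlePoint_lt_one hρ t)).tsum_eq,
    fun t => (hG _ (norm_mul_circlePoint_lt_one hρ t)).tsum_eq] at h
  rw [h]
  congr 1
  refine tsum_congr fun n => ?_
  rw [map_mul, map_pow, Complex.conj_ofReal, ← pow_mul, mul_comm 2 n, pow_mul]
  ring

/-! ### The inner product of `H²` through circle means -/

namespace HardySpace

theorem hasSum_apply (f : HardySpace) (z : 𝔻) :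
    HasSum (fun n => f.coeff n * (z : ℂ) ^ n) (f z) := by
  rw [apply_eq_tsum]
  exact (hasSum_inner_szego z f).summable.hasSum

theorem inner_szego (z : 𝔻) (f : HardySpace) : inner ℂ (szego z) f = f z :=
  (hasSum_inner_szego z f).unique (hasSum_apply f z)

theorem hasSum_of_eqOn {f : HardySpace} {F : ℂ → ℂ} (hF : ∀ z : 𝔻, f z = F z) (z : ℂ)
    (hz : ‖z‖ < 1) : HasSum (fun n => f.coeff n * z ^ n) (F z) := by
  have h := hasSum_apply f (Complex.UnitDisc.mk z hz)
  rwa [hF] at h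

/-- The inner product of `H²` as a limit of integrals over circles. -/
theorem tendsto_integral_inner {f g : HardySpace} {F G : ℂ → ℂ} (hF : ∀ z : 𝔻, f z = F z)
    (hG : ∀ z : 𝔻, g z = G z) :
    Tendsto (fun ρ : ℝ => ∫ t in -Real.pi..Real.pi,
        conj (F (ρ * circlePoint t)) * G (ρ * circlePoint t))
      (𝓝[<] 1) (𝓝 (2 * Real.pi * inner ℂ f g)) := by
  have hi := lp.hasSum_inner (𝕜 := ℂ) (show lp (fun _ : ℕ => ℂ) 2 from f)
    (show lp (fun _ : ℕ => ℂ) 2 from g)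
  have hi' : HasSum (fun n => conj (f.coeff n) * g.coeff n) (inner ℂ f g) :=
    hi.congr_fun fun n => by simp [coeff, mul_comm]
  rw [← hi'.tsum_eq]
  have hmem : Ioo (0 : ℝ) 1 ∈ 𝓝[<] (1 : ℝ) := Ioo_mem_nhdsLT one_pos
  have hlim : Tendsto (fun ρ : ℝ => ∑' n, conj (f.coeff n) * g.coeff n * ((ρ : ℂ) ^ 2) ^ n)
      (𝓝[<] 1) (𝓝 (∑' n, conj (f.coeff n) * g.coeff n)) := by
    refine tendsto_tsum_of_dominated_convergence hi'.summable.norm (fun n => ?_) ?_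
    · have hc : Continuous fun ρ : ℝ => conj (f.coeff n) * g.coeff n * ((ρ : ℂ) ^ 2) ^ n := by
        fun_prop
      have h1 := (hc.tendsto 1).mono_left (nhdsWithin_le_nhds (s := Iio 1))
      simpa using h1
    · filter_upwards [hmem] with ρ hρ n
      rw [norm_mul]
      refine mul_le_of_le_one_right (norm_nonneg _) ?_
      rw [norm_pow, norm_pow, Complex.norm_real, Real.norm_of_nonneg hρ.1.le]
      exact pow_le_one₀ (by positivity) (pow_le_one₀ hρ.1.le hρ.2.le)
  refine (hlim.const_mul (2 * (Real.pi : ℂ))).congr' ?_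
  filter_upwards [hmem] with ρ hρ
  exact (integral_conj_mul_of_hasSum (hasSum_of_eqOn hF) (hasSum_of_eqOn hG) hρ).symm

end HardySpace

/-- A bounded analytic function on the disk belongs to `H²`. -/
theorem exists_hardySpace_of_bounded {F : ℂ → ℂ} (hd : DifferentiableOn ℂ F (Metric.ball 0 1))
    (hb : ∀ z ∈ Metric.ball (0 : ℂ) 1, ‖F z‖ ≤ 1) :
    ∃ f : HardySpace, ∀ z : 𝔻, f z = F z := by
  set a : ℕ → ℂ := fun n => ((n.factorial : ℂ))⁻¹ * iteratedDeriv n F 0 with ha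
  have hF : ∀ z, ‖z‖ < 1 → HasSum (fun n => a n * z ^ n) (F z) := by
    intro z hz
    have h := Complex.hasSum_taylorSeries_on_ball hd (mem_ball_zero_iff.2 hz)
    refine h.congr_fun fun n => ?_
    simp only [ha, sub_zero, smul_eq_mul]
    ring
  -- A bound on finite sums, uniform in `ρ`, survives `ρ → 1` by mere continuity.
  have hbound : ∀ ρ ∈ Ioo (0 : ℝ) 1, ∀ s : Finset ℕ, ∑ n ∈ s, ‖a n‖ ^ 2 * (ρ ^ 2) ^ n ≤ 1 := by
    intro ρ hρ s
    have h := integral_conj_mul_of_hasSum hF hF hρ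
    have hρ1 : ‖(ρ : ℂ)‖ < 1 := by
      rw [Complex.norm_real, Real.norm_of_nonneg hρ.1.le]
      exact hρ.2
    have hsum : Summable fun n => ‖a n‖ ^ 2 * (ρ ^ 2) ^ n := by
      have h1 := (hF ρ hρ1).summable.norm
      -- The diagonal of a summable double family.
      have h2 : Summable fun n => ‖a n * (ρ : ℂ) ^ n‖ * ‖a n * (ρ : ℂ) ^ n‖ := by
        refine Summable.mul_of_nonneg h1 h1 (fun _ => norm_nonneg _) (fun _ => norm_nonneg _)
          |>.comp_injective (i := fun n : ℕ => (n, n)) fun m n hmn => by simpa using hmn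
      refine h2.congr fun n => ?_
      rw [norm_mul, norm_pow, Complex.norm_real, Real.norm_of_nonneg hρ.1.le]
      ring
    have hle : ‖∫ t in -Real.pi..Real.pi,
        conj (F (ρ * circlePoint t)) * F (ρ * circlePoint t)‖ ≤ 1 * |Real.pi - -Real.pi| := by
      refine intervalIntegral.norm_integral_le_of_norm_le_const fun t _ => ?_
      have hz := hb _ (mem_ball_zero_iff.2 (norm_mul_circlePoint_lt_one hρ t))
      rw [norm_mul, RCLike.norm_conj]
      exact mul_le_one₀ hz (norm_nonneg _) hz
    have hreal : ∑' n, conj (a n) * a n * ((ρ : ℂ) ^ 2) ^ n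
        = ((∑' n, ‖a n‖ ^ 2 * (ρ ^ 2) ^ n : ℝ) : ℂ) := by
      rw [Complex.ofReal_tsum]
      refine tsum_congr fun n => ?_
      rw [Complex.conj_mul']
      push_cast
      rfl
    rw [h, hreal, norm_mul, Complex.norm_real,
      Real.norm_of_nonneg (tsum_nonneg fun n => by positivity)] at hle
    have hpi : ‖(2 * Real.pi : ℂ)‖ = 2 * Real.pi := by
      simp [abs_of_pos Real.pi_pos]
    rw [hpi, one_mul, sub_neg_eq_add, abs_of_pos (by positivity), ← two_mul] at hle
    have hle' : ∑' n, ‖a n‖ ^ 2 * (ρ ^ 2) ^ n ≤ 1 :=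
      le_of_mul_le_mul_left (by simpa using hle) Real.two_pi_pos
    exact (hsum.sum_le_tsum s fun n _ => by positivity).trans hle'
  have hmem : Memℓp a (2 : ℝ≥0∞) := by
    rw [memℓp_gen_iff (by norm_num)]
    refine summable_of_sum_le (c := 1) (fun n => by positivity) fun s => ?_
    have hc : Continuous fun ρ : ℝ => ∑ n ∈ s, ‖a n‖ ^ 2 * (ρ ^ 2) ^ n := by fun_prop
    have h1 := (hc.tendsto 1).mono_left (nhdsWithin_le_nhds (s := Iio 1))
    have h2 := le_of_tendsto h1
      (by filter_upwards [Ioo_mem_nhdsLT (zero_lt_one (α := ℝ))] with ρ hρ using hbound ρ hρ s)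
    simpa using h2
  refine ⟨(⟨a, hmem⟩ : lp (fun _ : ℕ => ℂ) 2), fun z => ?_⟩
  exact (hF z z.norm_lt_one).tsum_eq

/-! ### Multiplication by an inner function -/

namespace IsInner

variable {I : ℂ → ℂ}

/-- Multiplication by an inner function preserves inner products of monomials. -/
theorem inner_mul_pow (hI : IsInner I) {m n : ℕ} {f g : HardySpace}
    (hf : ∀ z : 𝔻, f z = I z * (z : ℂ) ^ m) (hg : ∀ z : 𝔻, g z = I z * (z : ℂ) ^ n) :
    inner ℂ f g = if m = n then 1 else 0 := by
  have h1 := HardySpace.tendsto_integral_inner (F := fun z => I z * z ^ m)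
    (G := fun z => I z * z ^ n) hf hg
  have hmem : Ioo (0 : ℝ) 1 ∈ 𝓝[<] (1 : ℝ) := Ioo_mem_nhdsLT one_pos
  -- Dominated convergence with bound `1`: the radial limit `w` enters only as `conj w * w = 1`, so
  -- `I` disappears from the limit.
  have h2 : Tendsto (fun ρ : ℝ => ∫ t in -Real.pi..Real.pi,
        conj (I (ρ * circlePoint t) * ((ρ : ℂ) * circlePoint t) ^ m) *
          (I (ρ * circlePoint t) * ((ρ : ℂ) * circlePoint t) ^ n)) (𝓝[<] 1)
      (𝓝 (∫ t in -Real.pi..Real.pi,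
        conj ((circlePoint t : ℂ) ^ m) * (circlePoint t : ℂ) ^ n)) := by
    refine intervalIntegral.tendsto_integral_filter_of_dominated_convergence (fun _ => 1)
      ?_ ?_ intervalIntegrable_const ?_
    · filter_upwards [hmem] with ρ hρ
      have hcp := continuous_circlePoint
      have hc : Continuous fun t : ℝ => I (ρ * circlePoint t) :=
        hI.differentiableOn.continuousOn.comp_continuous (by fun_prop)
          fun t => mem_ball_zero_iff.2 (norm_mul_circlePoint_lt_one hρ t)
      have hk : ∀ k : ℕ, Continuous fun t : ℝ =>
          I (ρ * circlePoint t) * ((ρ : ℂ) * circlePoint t) ^ k := fun k => hc.mul (by fun_prop)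
      exact ((Complex.continuous_conj.comp (hk m)).mul (hk n)).aestronglyMeasurable
    · filter_upwards [hmem] with ρ hρ
      refine .of_forall fun t _ => ?_
      have hlt := norm_mul_circlePoint_lt_one hρ t
      have hz := hI.norm_le_one _ (mem_ball_zero_iff.2 hlt)
      have hk : ∀ k : ℕ, ‖I (ρ * circlePoint t) * ((ρ : ℂ) * circlePoint t) ^ k‖ ≤ 1 := by
        intro k
        rw [norm_mul, norm_pow]
        exact mul_le_one₀ hz (by positivity) (pow_le_one₀ (norm_nonneg _) hlt.le)
      rw [norm_mul, RCLike.norm_conj]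
      exact mul_le_one₀ (hk m) (norm_nonneg _) (hk n)
    · filter_upwards [hI.radial_limit] with t ⟨w, hw, ht⟩ _
      have hk : ∀ k : ℕ, Tendsto (fun ρ : ℝ => I (ρ * circlePoint t) *
          ((ρ : ℂ) * circlePoint t) ^ k) (𝓝[<] 1) (𝓝 (w * (circlePoint t : ℂ) ^ k)) := by
        intro k
        have hc : Continuous fun ρ : ℝ => ((ρ : ℂ) * circlePoint t) ^ k := by fun_prop
        have hp := (hc.tendsto 1).mono_left (nhdsWithin_le_nhds (s := Iio 1))
        simp only [Complex.ofReal_one, one_mul] at hp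
        exact ht.mul hp
      have h := ((Complex.continuous_conj.tendsto _).comp (hk m)).mul (hk n)
      have hw1 : conj w * w = 1 := by
        rw [Complex.conj_mul', hw]
        simp
      have e : conj (w * (circlePoint t : ℂ) ^ m) * (w * (circlePoint t : ℂ) ^ n)
          = conj ((circlePoint t : ℂ) ^ m) * (circlePoint t : ℂ) ^ n := by
        rw [map_mul]
        linear_combination conj ((circlePoint t : ℂ) ^ m) * (circlePoint t : ℂ) ^ n * hw1
      rw [e] at h
      exact h
  have h3 := tendsto_nhds_unique h1 h2
  rw [integral_conj_circlePoint_pow_mul_pow] at h3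
  have hpi : (2 * (Real.pi : ℂ)) ≠ 0 :=
    mul_ne_zero two_ne_zero (Complex.ofReal_ne_zero.2 Real.pi_ne_zero)
  refine mul_left_cancel₀ hpi (h3.trans ?_)
  split_ifs <;> simp

/-- Multiplication by an inner function is an isometry of `H²`. -/
theorem exists_isometry (hI : IsInner I) :
    ∃ T : HardySpace →ₗᵢ[ℂ] HardySpace, ∀ (g : HardySpace) (z : 𝔻), T g z = I z * g z := by
  have hex : ∀ n : ℕ, ∃ f : HardySpace, ∀ z : 𝔻, f z = I z * (z : ℂ) ^ n := fun n =>
    exists_hardySpace_of_bounded (F := fun z => I z * z ^ n)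
      (hI.differentiableOn.mul (differentiable_id.pow n).differentiableOn) fun z hz => by
        rw [norm_mul, norm_pow]
        exact mul_le_one₀ (hI.norm_le_one z hz) (by positivity)
          (pow_le_one₀ (norm_nonneg _) (mem_ball_zero_iff.1 hz).le)
  choose e he using hex
  have hon : Orthonormal ℂ e :=
    orthonormal_iff_ite.2 fun m n => hI.inner_mul_pow (he m) (he n)
  -- `HardySpace` is `ℓ²` by definition, so the orthonormal family `e` itself defines the map `g ↦ ∑
  -- gₙ eₙ`.
  refine ⟨hon.orthogonalFamily.linearIsometry, fun g z => ?_⟩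
  have h := hon.orthogonalFamily.hasSum_linearIsometry g
  have h1 := h.mapL (HardySpace.evalCLM z)
  have h2 := (HardySpace.hasSum_apply g z).mul_left (I z)
  refine h1.unique (h2.congr_fun fun n => ?_)
  have h3 : HardySpace.evalCLM z (e n) = I z * (z : ℂ) ^ n := he n z
  simp only [LinearIsometry.toSpanSingleton_apply, map_smul, smul_eq_mul, h3]
  simp only [HardySpace.coeff]
  ring

end IsInner

theorem HardySpace.szego_apply (w z : 𝔻) : szego w z = 1 / (1 - conj (w : ℂ) * z) := by
  have hlt : ‖conj (w : ℂ) * z‖ < 1 := by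
    rw [norm_mul, RCLike.norm_conj]
    exact mul_lt_one_of_nonneg_of_lt_one_left (norm_nonneg _) w.norm_lt_one z.norm_lt_one.le
  have h := hasSum_geometric_of_norm_lt_one hlt
  rw [one_div]
  refine (hasSum_apply (szego w) z).unique (h.congr_fun fun n => ?_)
  rw [mul_pow]
  rfl

theorem modelSpace_apply {I : ℂ → ℂ} (f : modelSpace I) (z : 𝔻) : f z = (f : HardySpace) z := rfl

/-! ### The kernel of the model space and its norm -/

namespace IsInner

variable {I : ℂ → ℂ}

/-- The reproducing kernel of the model space of an inner function. -/
theorem modelKernel_apply (hI : IsInner I) (w z : 𝔻) :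
    modelKernel I w z = (1 - conj (I w) * I z) / (1 - conj (w : ℂ) * z) := by
  obtain ⟨T, hT⟩ := hI.exists_isometry
  set k : HardySpace := HardySpace.szego w - conj (I w) • T (HardySpace.szego w) with hk
  have hperp : k ∈ modelSpace I := by
    rw [Submodule.mem_orthogonal']
    rintro f ⟨g, hg⟩
    -- Both terms of `⟪k, T g⟫` equal `I(w) g(w)`: the first by reproduction, the second because `T`
    -- preserves inner products.
    have hf : f = T g := RKHS.ext (𝕜 := ℂ) fun z => by rw [hg, hT]
    rw [hk, inner_sub_left, inner_smul_left, HardySpace.inner_szego, hf, T.inner_map_map,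
      HardySpace.inner_szego, hT, Complex.conj_conj, sub_self]
  have hrep : ∀ f : modelSpace I, inner ℂ (⟨k, hperp⟩ : modelSpace I) f = f w := by
    intro f
    have hmem : T (HardySpace.szego w) ∈ multipleSubspace I := ⟨HardySpace.szego w, hT _⟩
    rw [Submodule.coe_inner, Submodule.coe_mk]
    rw [hk, inner_sub_left, inner_smul_left, HardySpace.inner_szego,
      Submodule.inner_right_of_mem_orthogonal hmem f.2, mul_zero, sub_zero]
    rfl
  have heq : modelKernel I w = ⟨k, hperp⟩ := by
    refine ext_inner_right ℂ fun f => ?_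
    rw [hrep, modelKernel, RKHS.kerFun_inner]
    simp
  rw [heq, modelSpace_apply, Submodule.coe_mk]
  rw [hk, RKHS.coe_sub, RKHS.coe_smul]
  simp only [Pi.sub_apply, Pi.smul_apply, smul_eq_mul, hT, HardySpace.szego_apply]
  ring

theorem norm_modelKernel_sq (hI : IsInner I) (w : 𝔻) :
    ‖modelKernel I w‖ ^ 2 = (1 - ‖I w‖ ^ 2) / (1 - ‖(w : ℂ)‖ ^ 2) := by
  have h : inner ℂ (modelKernel I w) (modelKernel I w) = modelKernel I w w := by
    conv_lhs => rw [modelKernel, RKHS.kerFun_inner]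
    simp [modelKernel]
  rw [inner_self_eq_norm_sq_to_K, hI.modelKernel_apply, Complex.conj_mul', Complex.conj_mul'] at h
  exact Complex.ofReal_injective (by push_cast; exact h)

end IsInner

/-! ### The pointwise estimate from admissibility -/

namespace IsAdmissible

variable {φ : ℝ → ℝ}

/-- For `x ≤ s` monotonicity of `φ` suffices; for `x ≥ s` the decrease of `φ(x)/x²` does, with `x ≤
s + d ≤ 2d` producing the `4`. Applied with `s = 1 - r`, `x = |1 - a|`, `d = |1 - conj a r|`. -/
theorem mul_sq_le (hφ : IsAdmissible φ) {s x d : ℝ} (hs : 0 < s) (hx : 0 < x) (hsd : s ≤ d)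
    (hxd : x - s ≤ d) : φ x * s ^ 2 ≤ 4 * φ s * d ^ 2 := by
  have hφs := hφ.pos s hs
  rcases le_total x s with h | h
  · have h1 : φ x ≤ φ s := hφ.monotoneOn hx hs h
    have h2 : s ^ 2 ≤ d ^ 2 := pow_le_pow_left₀ hs.le hsd 2
    nlinarith [mul_le_mul h1 h2 (by positivity) hφs.le, mul_nonneg hφs.le (sq_nonneg d)]
  · have h1 : φ x / x ^ 2 ≤ φ s / s ^ 2 := hφ.antitoneOn_div_sq hs hx h
    rw [div_le_div_iff₀ (by positivity) (by positivity)] at h1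
    have h2 : x ^ 2 ≤ (2 * d) ^ 2 := pow_le_pow_left₀ hx.le (by linarith) 2
    nlinarith [mul_le_mul_of_nonneg_left h2 hφs.le]

theorem ofReal_one_div_sq_le (hφ : IsAdmissible φ) {s x d : ℝ} (hs : 0 < s) (hx : 0 ≤ x)
    (hsd : s ≤ d) (hxd : x - s ≤ d) :
    ENNReal.ofReal (1 / d ^ 2) ≤ ENNReal.ofReal (4 * (φ s / s ^ 2)) * (1 / extendZero φ x) := by
  have hφs := hφ.pos s hs
  have hd : 0 < d := hs.trans_le hsd
  rcases hx.eq_or_lt with rfl | hx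
  -- At `x = 0` the right side is `∞`, provided its first factor is not zero.
  · have h0 : ENNReal.ofReal (4 * (φ s / s ^ 2)) ≠ 0 := by
      rw [Ne, ENNReal.ofReal_eq_zero, not_le]
      positivity
    rw [extendZero, if_pos rfl, ENNReal.div_zero one_ne_zero, ENNReal.mul_top h0]
    exact le_top
  · have hφx := hφ.pos x hx
    rw [extendZero, if_neg hx.ne', one_div (ENNReal.ofReal _), ← ENNReal.ofReal_inv_of_pos hφx,
      ← ENNReal.ofReal_mul (by positivity)]
    refine ENNReal.ofReal_le_ofReal ?_
    have h := hφ.mul_sq_le hs hx hsd hxd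
    rw [← mul_div_assoc, ← div_eq_mul_inv, div_div,
      div_le_div_iff₀ (by positivity) (by positivity)]
    linarith

end IsAdmissible

/-! ### Blaschke products -/

theorem one_sub_conj_mul_ne_zero {a z : ℂ} (ha : ‖a‖ < 1) (hz : ‖z‖ < 1) :
    1 - conj a * z ≠ 0 := by
  intro h
  have h1 : ‖conj a * z‖ = 1 := by rw [← sub_eq_zero.1 h, norm_one]
  rw [norm_mul, RCLike.norm_conj] at h1
  exact (mul_lt_one_of_nonneg_of_lt_one_left (norm_nonneg _) ha hz.le).ne h1

theorem one_sub_norm_blaschkeFactor_sq {a z : ℂ} (ha : ‖a‖ < 1) (hz : ‖z‖ < 1) :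
    1 - ‖blaschkeFactor a z‖ ^ 2
      = (1 - ‖a‖ ^ 2) * (1 - ‖z‖ ^ 2) * (1 / ‖1 - conj a * z‖ ^ 2) := by
  by_cases h0 : a = 0
  · simp [blaschkeFactor, h0]
  have hne := norm_ne_zero_iff.2 (one_sub_conj_mul_ne_zero ha hz)
  have ha0 := norm_ne_zero_iff.2 h0
  rw [blaschkeFactor, if_neg h0, norm_mul, norm_div, norm_div, Complex.norm_real, norm_norm,
    div_self ha0, one_mul]
  have key : ‖1 - conj a * z‖ ^ 2 - ‖a - z‖ ^ 2 = (1 - ‖a‖ ^ 2) * (1 - ‖z‖ ^ 2) := by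
    simp only [Complex.sq_norm, Complex.normSq_apply, Complex.sub_re, Complex.sub_im,
      Complex.mul_re, Complex.mul_im, Complex.conj_re, Complex.conj_im, Complex.one_re,
      Complex.one_im]
    ring
  rw [← key, div_pow, mul_one_div, sub_div, div_self (pow_ne_zero 2 hne)]

theorem norm_blaschkeFactor_le_one {a z : ℂ} (ha : ‖a‖ < 1) (hz : ‖z‖ < 1) :
    ‖blaschkeFactor a z‖ ≤ 1 := by
  have h := one_sub_norm_blaschkeFactor_sq ha hz
  have h1 : 0 ≤ 1 - ‖a‖ ^ 2 := by nlinarith [norm_nonneg a]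
  have h2 : 0 ≤ 1 - ‖z‖ ^ 2 := by nlinarith [norm_nonneg z]
  have h3 : 0 ≤ 1 - ‖blaschkeFactor a z‖ ^ 2 := by rw [h]; positivity
  nlinarith [norm_nonneg (blaschkeFactor a z)]

theorem norm_blaschkeFactor_sub_one_le {a z : ℂ} (ha : ‖a‖ < 1) (hz : ‖z‖ < 1) :
    ‖blaschkeFactor a z - 1‖ ≤ 2 / (1 - ‖z‖) * (1 - ‖a‖) := by
  have hz' : 0 < 1 - ‖z‖ := sub_pos.2 hz
  by_cases h0 : a = 0
  · simp only [blaschkeFactor, h0, if_true, norm_zero, sub_zero, mul_one]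
    rw [le_div_iff₀ hz']
    have h1 := norm_sub_le z 1
    rw [norm_one] at h1
    nlinarith [norm_nonneg z]
  have hne := one_sub_conj_mul_ne_zero ha hz
  have hmul : conj a * a = (‖a‖ : ℂ) ^ 2 := Complex.conj_mul' a
  -- The numerator `|a|(a - z) - a(1 - conj a z)` factors as `-(1 - |a|)(a + |a| z)` because `conj a
  -- * a = |a|²`.
  have key : blaschkeFactor a z - 1
      = -((1 - ‖a‖ : ℝ) : ℂ) * ((a + ‖a‖ * z) / (a * (1 - conj a * z))) := by
    rw [blaschkeFactor, if_neg h0]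
    rw [mul_comm (conj a) z] at hne ⊢
    field_simp
    push_cast
    linear_combination z * hmul
  have ha0 : 0 < ‖a‖ := norm_pos_iff.2 h0
  have hden : 1 - ‖z‖ ≤ ‖1 - conj a * z‖ := by
    have h1 := norm_sub_norm_le (1 : ℂ) (conj a * z)
    rw [norm_one, norm_mul, RCLike.norm_conj] at h1
    nlinarith [norm_nonneg z]
  have hnum : ‖a + ‖a‖ * z‖ ≤ 2 * ‖a‖ := by
    have h1 := norm_add_le a (‖a‖ * z)
    rw [norm_mul, Complex.norm_real, norm_norm] at h1
    nlinarith
  rw [key, norm_mul, norm_neg, Complex.norm_real, Real.norm_of_nonneg (by linarith), mul_comm]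
  refine mul_le_mul_of_nonneg_right ?_ (by linarith)
  rw [norm_div, norm_mul, div_le_div_iff₀ (by positivity) hz']
  calc ‖a + ‖a‖ * z‖ * (1 - ‖z‖) ≤ 2 * ‖a‖ * ‖1 - conj a * z‖ :=
        mul_le_mul hnum hden hz'.le (by positivity)
    _ = 2 * (‖a‖ * ‖1 - conj a * z‖) := by ring

/-- Convergence of a Blaschke product on the disk. -/
theorem multipliable_blaschkeFactor {ι : Type*} {lam : ι → ℂ} (hlam : ∀ n, ‖lam n‖ < 1)
    (hsum : Summable fun n => 1 - ‖lam n‖) {z : ℂ} (hz : ‖z‖ < 1) :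
    Multipliable fun n => blaschkeFactor (lam n) z := by
  have h : Summable fun n => ‖blaschkeFactor (lam n) z - 1‖ :=
    .of_nonneg_of_le (fun _ => norm_nonneg _)
      (fun n => norm_blaschkeFactor_sub_one_le (hlam n) hz) (hsum.mul_left _)
  simpa using multipliable_one_add_of_summable h

/-- Induction on `1 - xy = (1-x) + (1-y) - (1-x)(1-y)`, whose last product is nonnegative. -/
theorem one_sub_prod_le_sum_one_sub {ι : Type*} (s : Finset ι) {f : ι → ℝ} (h0 : ∀ i, 0 ≤ f i)
    (h1 : ∀ i, f i ≤ 1) : 1 - ∏ i ∈ s, f i ≤ ∑ i ∈ s, (1 - f i) := by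
  classical
  induction s using Finset.induction_on with
  | empty => simp
  | insert i s hi ih =>
    rw [Finset.prod_insert hi, Finset.sum_insert hi]
    have hp0 : 0 ≤ ∏ j ∈ s, f j := Finset.prod_nonneg fun j _ => h0 j
    have hp1 : ∏ j ∈ s, f j ≤ 1 := Finset.prod_le_one (fun j _ => h0 j) fun j _ => h1 j
    nlinarith [mul_nonneg (sub_nonneg.2 (h1 i)) (sub_nonneg.2 hp1)]

theorem ofReal_one_sub_norm_blaschkeProduct_sq_le {ι : Type*} {lam : ι → ℂ}
    (hlam : ∀ n, ‖lam n‖ < 1) (hsum : Summable fun n => 1 - ‖lam n‖) {z : ℂ} (hz : ‖z‖ < 1) :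
    ENNReal.ofReal (1 - ‖blaschkeProduct lam z‖ ^ 2)
      ≤ ∑' n, ENNReal.ofReal (1 - ‖blaschkeFactor (lam n) z‖ ^ 2) := by
  have hprod : Tendsto (fun s : Finset ι => ∏ n ∈ s, blaschkeFactor (lam n) z) atTop
      (𝓝 (blaschkeProduct lam z)) := (multipliable_blaschkeFactor hlam hsum hz).hasProd
  have hlim := ENNReal.tendsto_ofReal ((hprod.norm.pow 2).const_sub 1)
  refine le_of_tendsto' hlim fun s => ?_
  have hle : ∀ n, ‖blaschkeFactor (lam n) z‖ ^ 2 ≤ 1 := fun n =>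
    pow_le_one₀ (norm_nonneg _) (norm_blaschkeFactor_le_one (hlam n) hz)
  rw [norm_prod, ← Finset.prod_pow]
  refine (ENNReal.ofReal_le_ofReal
    (one_sub_prod_le_sum_one_sub s (fun n => by positivity) hle)).trans ?_
  rw [ENNReal.ofReal_sum_of_nonneg fun n _ => sub_nonneg.2 (hle n)]
  exact ENNReal.sum_le_tsum s

/-! ### Singular inner functions -/

theorem unitCircle_sub_ne_zero (ζ : UnitCircle) {z : ℂ} (hz : ‖z‖ < 1) : (ζ : ℂ) - z ≠ 0 := by
  intro h
  rw [← sub_eq_zero.1 h, norm_eq_of_mem_sphere] at hz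
  exact hz.ne rfl

theorem re_herglotz_eq_poisson (ζ : UnitCircle) {z : ℂ} (hz : ‖z‖ < 1) :
    (((ζ : ℂ) + z) / ((ζ : ℂ) - z)).re = (1 - ‖z‖ ^ 2) * (1 / ‖(ζ : ℂ) - z‖ ^ 2) := by
  have hne := unitCircle_sub_ne_zero ζ hz
  have hζ : ‖(ζ : ℂ)‖ ^ 2 = 1 := by rw [norm_eq_of_mem_sphere, one_pow]
  have hN : Complex.normSq ((ζ : ℂ) - z) ≠ 0 := mt Complex.normSq_eq_zero.1 hne
  rw [Complex.sq_norm] at hζ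
  rw [Complex.div_re, Complex.sq_norm, Complex.sq_norm]
  field_simp
  -- Writing `1` as `|ζ|²` leaves a polynomial identity.
  refine Eq.trans ?_ (congrArg (· - Complex.normSq z) hζ)
  simp only [Complex.normSq_apply, Complex.add_re, Complex.add_im, Complex.sub_re,
    Complex.sub_im]
  ring

/-- `|S_μ|²` is the exponential of minus twice the Poisson integral, and `1 - exp (-x) ≤ x`. -/
theorem ofReal_one_sub_norm_singularInner_sq_le (μ : Measure UnitCircle) [IsFiniteMeasure μ]
    {z : ℂ} (hz : ‖z‖ < 1) :
    ENNReal.ofReal (1 - ‖singularInner μ z‖ ^ 2)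
      ≤ ∫⁻ ζ : UnitCircle, ENNReal.ofReal (2 * (1 - ‖z‖ ^ 2) * (1 / ‖(ζ : ℂ) - z‖ ^ 2)) ∂μ := by
  have hcont : Continuous fun ζ : UnitCircle => ((ζ : ℂ) + z) / ((ζ : ℂ) - z) :=
    (by fun_prop : Continuous fun ζ : UnitCircle => (ζ : ℂ) + z).div (by fun_prop)
      fun ζ => unitCircle_sub_ne_zero ζ hz
  have hint : Integrable (fun ζ : UnitCircle => ((ζ : ℂ) + z) / ((ζ : ℂ) - z)) μ :=
    hcont.integrable_of_hasCompactSupport (HasCompactSupport.of_compactSpace _)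
  have hre : (∫ ζ : UnitCircle, ((ζ : ℂ) + z) / ((ζ : ℂ) - z) ∂μ).re
      = ∫ ζ : UnitCircle, (((ζ : ℂ) + z) / ((ζ : ℂ) - z)).re ∂μ := (integral_re hint).symm
  have hnorm : ‖singularInner μ z‖ ^ 2
      = Real.exp (-∫ ζ : UnitCircle, 2 * (((ζ : ℂ) + z) / ((ζ : ℂ) - z)).re ∂μ) := by
    rw [singularInner, Complex.norm_exp, Complex.neg_re, hre, ← Real.exp_nat_mul,
      integral_const_mul]
    congr 1
    push_cast
    ring
  have hle : 1 - ‖singularInner μ z‖ ^ 2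
      ≤ ∫ ζ : UnitCircle, 2 * (((ζ : ℂ) + z) / ((ζ : ℂ) - z)).re ∂μ := by
    rw [hnorm]
    linarith [Real.add_one_le_exp (-∫ ζ : UnitCircle, 2 * (((ζ : ℂ) + z) / ((ζ : ℂ) - z)).re ∂μ)]
  refine (ENNReal.ofReal_le_ofReal hle).trans ?_
  have h1 : 0 ≤ 1 - ‖z‖ ^ 2 := by nlinarith [norm_nonneg z]
  have hint' : Integrable (fun ζ : UnitCircle => 2 * (((ζ : ℂ) + z) / ((ζ : ℂ) - z)).re) μ :=
    hint.re.const_mul 2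
  rw [ofReal_integral_eq_lintegral_ofReal hint'
    (.of_forall fun ζ => by
      simp only [Pi.zero_apply]
      rw [re_herglotz_eq_poisson ζ hz]
      positivity)]
  refine lintegral_mono fun ζ => le_of_eq ?_
  rw [re_herglotz_eq_poisson ζ hz, mul_assoc]

/-! ### Distances to a radial point and the final bound -/

theorem one_sub_le_norm_one_sub_conj_mul {a : ℂ} (ha : ‖a‖ ≤ 1) {r : ℝ} (hr : 0 ≤ r) :
    1 - r ≤ ‖1 - conj a * r‖ := by
  have h := norm_sub_norm_le (1 : ℂ) (conj a * r)
  rw [norm_one, norm_mul, RCLike.norm_conj, Complex.norm_real, Real.norm_of_nonneg hr] at h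
  nlinarith

theorem norm_one_sub_sub_le_norm_one_sub_conj_mul {a : ℂ} (ha : ‖a‖ ≤ 1) {r : ℝ} (hr : r ≤ 1) :
    ‖1 - a‖ - (1 - r) ≤ ‖1 - conj a * r‖ := by
  have hconj : ‖1 - conj a * r‖ = ‖1 - a * r‖ := by
    rw [← RCLike.norm_conj]
    simp
  have h : ‖1 - a‖ ≤ ‖1 - a * r‖ + ‖a * ((1 - r : ℝ) : ℂ)‖ := by
    rw [show 1 - a = (1 - a * r) - a * ((1 - r : ℝ) : ℂ) by push_cast; ring]
    exact norm_sub_le _ _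
  rw [norm_mul, Complex.norm_real, Real.norm_of_nonneg (sub_nonneg.2 hr)] at h
  rw [hconj]
  nlinarith

/-- Lets the Poisson kernel use the same estimate as the Blaschke factors. -/
theorem norm_unitCircle_sub_ofReal (ζ : UnitCircle) (r : ℝ) :
    ‖(ζ : ℂ) - r‖ = ‖1 - conj (ζ : ℂ) * r‖ := by
  have h : conj (ζ : ℂ) * ζ = 1 := by
    rw [Complex.conj_mul', norm_eq_of_mem_sphere]
    simp
  have h1 : ‖conj (ζ : ℂ)‖ = 1 := by rw [RCLike.norm_conj, norm_eq_of_mem_sphere]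
  rw [← h, ← mul_sub, norm_mul, h1, one_mul]

/-- The bound of `1 - |I(r)|²` in terms of the zeros and the singular measure. -/
theorem IsFactorization.ofReal_one_sub_norm_sq_le {ι : Type*} {I : ℂ → ℂ} {lam : ι → ℂ}
    {μ : Measure UnitCircle} {φ : ℝ → ℝ} (hfac : IsFactorization I lam μ) (hφ : IsAdmissible φ)
    {r : ℝ} (hr : r ∈ Ioo (0 : ℝ) 1) :
    ENNReal.ofReal (1 - ‖I r‖ ^ 2)
      ≤ ENNReal.ofReal (2 * (1 - r ^ 2)) * ENNReal.ofReal (4 * (φ (1 - r) / (1 - r) ^ 2))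
        * growthSum φ lam μ := by
  have := hfac.isFiniteMeasure
  have hrn : ‖(r : ℂ)‖ = r := by rw [Complex.norm_real, Real.norm_of_nonneg hr.1.le]
  have hr1 : ‖(r : ℂ)‖ < 1 := hrn.trans_lt hr.2
  have hs : 0 < 1 - r := sub_pos.2 hr.2
  have hr2 : 0 ≤ 1 - r ^ 2 := by nlinarith [hr.1, hr.2]
  set K := ENNReal.ofReal (2 * (1 - r ^ 2)) * ENNReal.ofReal (4 * (φ (1 - r) / (1 - r) ^ 2))
    with hK
  have hpoint : ∀ a : ℂ, ‖a‖ ≤ 1 → ENNReal.ofReal (1 / ‖1 - conj a * r‖ ^ 2)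
      ≤ ENNReal.ofReal (4 * (φ (1 - r) / (1 - r) ^ 2)) * (1 / extendZero φ ‖1 - a‖) :=
    fun a ha => hφ.ofReal_one_div_sq_le hs (norm_nonneg _)
      (one_sub_le_norm_one_sub_conj_mul ha hr.1.le)
      (norm_one_sub_sub_le_norm_one_sub_conj_mul ha hr.2.le)
  have hB : ENNReal.ofReal (1 - ‖blaschkeProduct lam r‖ ^ 2)
      ≤ K * ∑' n, ENNReal.ofReal (1 - ‖lam n‖) / extendZero φ ‖1 - lam n‖ := by
    refine (ofReal_one_sub_norm_blaschkeProduct_sq_le hfac.norm_lt_one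
      hfac.blaschke_condition hr1).trans ?_
    rw [← ENNReal.tsum_mul_left]
    refine ENNReal.tsum_le_tsum fun n => ?_
    have hn := hfac.norm_lt_one n
    rw [one_sub_norm_blaschkeFactor_sq hn hr1, hrn]
    -- `2(1 - t) - (1 - t²) = (1 - t)²`; the `2` matches the one in the singular part.
    have h1 : (1 - ‖lam n‖ ^ 2) * (1 - r ^ 2) ≤ 2 * (1 - r ^ 2) * (1 - ‖lam n‖) := by
      nlinarith [mul_nonneg hr2 (sq_nonneg (1 - ‖lam n‖))]
    calc ENNReal.ofReal ((1 - ‖lam n‖ ^ 2) * (1 - r ^ 2) * (1 / ‖1 - conj (lam n) * r‖ ^ 2))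
        ≤ ENNReal.ofReal
            (2 * (1 - r ^ 2) * (1 - ‖lam n‖) * (1 / ‖1 - conj (lam n) * r‖ ^ 2)) :=
          ENNReal.ofReal_le_ofReal (mul_le_mul_of_nonneg_right h1 (by positivity))
      _ = ENNReal.ofReal (2 * (1 - r ^ 2)) * ENNReal.ofReal (1 - ‖lam n‖)
            * ENNReal.ofReal (1 / ‖1 - conj (lam n) * r‖ ^ 2) := by
          rw [ENNReal.ofReal_mul (mul_nonneg (by positivity) (sub_nonneg.2 hn.le)),
            ENNReal.ofReal_mul (by positivity)]
      _ ≤ ENNReal.ofReal (2 * (1 - r ^ 2)) * ENNReal.ofReal (1 - ‖lam n‖)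
            * (ENNReal.ofReal (4 * (φ (1 - r) / (1 - r) ^ 2))
              * (1 / extendZero φ ‖1 - lam n‖)) :=
          mul_le_mul_right (hpoint _ hn.le) _
      _ = K * (ENNReal.ofReal (1 - ‖lam n‖) / extendZero φ ‖1 - lam n‖) := by
          rw [hK, one_div, div_eq_mul_inv (ENNReal.ofReal (1 - ‖lam n‖))]
          ring
  have hS : ENNReal.ofReal (1 - ‖singularInner μ r‖ ^ 2)
      ≤ K * ∫⁻ ζ : UnitCircle, 1 / extendZero φ ‖1 - (ζ : ℂ)‖ ∂μ := by
    refine (ofReal_one_sub_norm_singularInner_sq_le μ hr1).trans ?_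
    rw [← lintegral_const_mul' _ _ (ENNReal.mul_ne_top ENNReal.ofReal_ne_top
      ENNReal.ofReal_ne_top)]
    refine lintegral_mono fun ζ => ?_
    rw [hrn, norm_unitCircle_sub_ofReal, ENNReal.ofReal_mul (by positivity), mul_assoc]
    exact mul_le_mul_right (hpoint _ (norm_eq_of_mem_sphere ζ).le) _
  obtain ⟨γ, hγ, hI⟩ := hfac.eq_mul
  have hnI : ‖I r‖ ^ 2 = ‖blaschkeProduct lam r‖ ^ 2 * ‖singularInner μ r‖ ^ 2 := by
    rw [hI r (mem_ball_zero_iff.2 hr1), norm_mul, norm_mul, hγ, one_mul, mul_pow]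
  have hB1 : ‖blaschkeProduct lam r‖ ≤ 1 :=
    le_of_tendsto' (multipliable_blaschkeFactor hfac.norm_lt_one hfac.blaschke_condition
      hr1).hasProd.norm fun s => by
        exact Finset.prod_le_one (fun n _ => norm_nonneg _)
          fun n _ => norm_blaschkeFactor_le_one (hfac.norm_lt_one n) hr1
  have hB2 : ‖blaschkeProduct lam r‖ ^ 2 ≤ 1 := pow_le_one₀ (norm_nonneg _) hB1
  have hsub : ENNReal.ofReal (1 - ‖I r‖ ^ 2)
      ≤ ENNReal.ofReal (1 - ‖blaschkeProduct lam r‖ ^ 2)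
        + ENNReal.ofReal (1 - ‖singularInner μ r‖ ^ 2) := by
    rw [hnI]
    rcases le_total (‖singularInner μ r‖ ^ 2) 1 with h | h
    · rw [← ENNReal.ofReal_add (sub_nonneg.2 hB2) (sub_nonneg.2 h)]
      refine ENNReal.ofReal_le_ofReal ?_
      nlinarith [mul_nonneg (sub_nonneg.2 hB2) (sub_nonneg.2 h)]
    -- Covering `|S_μ(r)| ≥ 1` as well avoids proving `|S_μ| ≤ 1`: here the Blaschke term alone
    -- suffices.
    · refine le_add_right (ENNReal.ofReal_le_ofReal ?_)
      nlinarith [sq_nonneg ‖blaschkeProduct lam r‖]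
  rw [growthSum, mul_add]
  exact hsub.trans (add_le_add hB hS)

theorem theorem2p1 {ι : Type*} [Countable ι] (I : ℂ → ℂ) (lam : ι → ℂ) (μ : Measure UnitCircle)
    (φ : ℝ → ℝ) (hI : IsInner I) (hfac : IsFactorization I lam μ) (hφ : IsAdmissible φ)
    (hsum : growthSum φ lam μ < ∞) :
    ∃ C : ℝ, 0 < C ∧ ∀ (r : ℝ) (hr : r ∈ Ioo (0 : ℝ) 1),
      (∀ z : 𝔻, modelKernel I (radialPoint r hr) z
        = (1 - conj (I r) * I z) / (1 - (r : ℂ) * z)) ∧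
      ‖modelKernel I (radialPoint r hr)‖ ^ 2 = (1 - ‖I r‖ ^ 2) / (1 - r ^ 2) ∧
      ‖modelKernel I (radialPoint r hr)‖ ^ 2 ≤ C * (φ (1 - r) / (1 - r) ^ 2) := by
  -- `8 = 2 · 4`; the `+ 1` keeps `C` positive when `growthSum` vanishes.
  refine ⟨8 * (growthSum φ lam μ).toReal + 1, by positivity, fun r hr => ?_⟩
  have hcoe : ((radialPoint r hr : 𝔻) : ℂ) = r := rfl
  have hnorm : ‖modelKernel I (radialPoint r hr)‖ ^ 2 = (1 - ‖I r‖ ^ 2) / (1 - r ^ 2) := by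
    rw [hI.norm_modelKernel_sq, hcoe, Complex.norm_real, Real.norm_of_nonneg hr.1.le]
  refine ⟨fun z => by rw [hI.modelKernel_apply, hcoe, Complex.conj_ofReal], hnorm, ?_⟩
  have hs : 0 < 1 - r := sub_pos.2 hr.2
  have hr2 : 0 < 1 - r ^ 2 := by nlinarith [hr.1, hr.2]
  have hφs := hφ.pos _ hs
  have hq : 0 < φ (1 - r) / (1 - r) ^ 2 := by positivity
  have h := hfac.ofReal_one_sub_norm_sq_le hφ hr
  rw [← ENNReal.ofReal_toReal hsum.ne, ← ENNReal.ofReal_mul (by positivity),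
    ← ENNReal.ofReal_mul (by positivity), ENNReal.ofReal_le_ofReal_iff (by positivity)] at h
  rw [hnorm, div_le_iff₀ hr2]
  nlinarith [mul_pos hq hr2]
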